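/- Let $\rho$ be the metric on $[0,\infty)$ induced by the map $f(t)=(t,\,t\sin t)$ into the Euclidean plane, i.e. $\rho(s,t)=\|f(s)-f(t)\|$, and take $0$ as base point, writing $|x|=\rho(0,x)$. Call $s:(0,\infty)\to(0,\infty)$ (not necessarily continuous) *asymptotically subpower* if for every $\alpha>0$ there is $t_0>0$ with $s(t)<t^{\alpha}$ for all $t>t_0$. For a proper metric space $X$ with base point, let $C_P(X)$ be the set of bounded continuous functions $g:X\to\mathbb R$ such that $\lim_{|x|\to\infty}\operatorname{diam} g\bigl(B(x,s(|x|))\bigr)=0$ for every asymptotically subpower $s$. The *subpower Higson compactification* $h_P(X)$ is the closure of the image of $X$ under the evaluation map $x\mapsto (g(x))_{g}$ in $\prod_{g\in C_P(X)}[\inf g,\sup g]$, and (identifying $X$ with its image) the *subpower Higson corona* is $\nu_P X=h_P(X)\setminus X$. A *continuum* is a nonempty compact connected Hausdorff space; it is *decomposable* if it is the union of two of its proper subcontinua. Then $f$ is a topological embedding, and $\rho$ is a proper metric inducing the usual topology of $[0,\infty)$. Moreover, for $X=([0,\infty),\rho)$, $Y=\{t\in X: t\sin t\ge 0\}$ and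 $Z=\{t\in X: t\sin t\le 0\}$, with closures taken in $h_P(X)$, the corona $\nu_P X$ is a continuum, $$\nu_P X=(\overline{Y}\setminus Y)\cup(\overline{Z}\setminus Z),$$ and $\overline{Y}\setminus Y$ and $\overline{Z}\setminus Z$ are both proper subcontinua of $\nu_P X$. In particular $\nu_P X$ is a decomposable continuum. -/

import Mathlib

open Filter Topology BoundedContinuousFunction

noncomputable section

/-- A (not necessarily continuous) function between the positive reals is asymptotically subpower
if it is eventually below `t ^ α` for every `α > 0`. Only the values `s t` with `0 < t` matter. -/
def AsymptoticallySubpower (s : ℝ → ℝ) : Prop :=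
  (∀ t : ℝ, 0 < t → 0 < s t) ∧
    ∀ α : ℝ, 0 < α → ∃ t₀ : ℝ, 0 < t₀ ∧ ∀ t : ℝ, t₀ < t → s t < t ^ α

/-- `f` is Higson subpower (with respect to the base point `x₀`): for every asymptotically
subpower `s`, the diameter of `f (B (x, s |x|))` tends to `0` as `|x| = dist x₀ x → ∞`. -/
def HigsonSubpower {X Y : Type*} [MetricSpace X] [MetricSpace Y] (x₀ : X) (f : X → Y) : Prop :=
  ∀ s : ℝ → ℝ, AsymptoticallySubpower s →
    Tendsto (fun x : X => Metric.ediam (f '' Metric.ball x (s (dist x₀ x))))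
      (comap (fun x : X => dist x₀ x) atTop) (𝓝 0)

/-- The set `C_P(X)` of bounded continuous real functions that are Higson subpower. -/
def subpowerFunctions {X : Type*} [MetricSpace X] (x₀ : X) : Set (X →ᵇ ℝ) :=
  {f | HigsonSubpower x₀ f}

theorem mem_Icc_iInf_iSup {X : Type*} [MetricSpace X] (f : X →ᵇ ℝ) (x : X) :
    f x ∈ Set.Icc (⨅ y, f y) (⨆ y, f y) :=
  ⟨ciInf_le f.isBounded_range.bddBelow x, le_ciSup f.isBounded_range.bddAbove x⟩

/-- The evaluation map of `C_P(X)` into the product of the intervals `[inf f, sup f]`. -/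
def subpowerEval {X : Type*} [MetricSpace X] (x₀ : X) (x : X) :
    (f : subpowerFunctions x₀) → Set.Icc (⨅ y, (f : X →ᵇ ℝ) y) (⨆ y, (f : X →ᵇ ℝ) y) :=
  fun f => ⟨(f : X →ᵇ ℝ) x, mem_Icc_iInf_iSup (f : X →ᵇ ℝ) x⟩

/-- The subpower Higson compactification `h_P(X)`: the closure of the image of the evaluation map,
with the subspace topology of the product topology. -/
abbrev SubpowerHigson {X : Type*} [MetricSpace X] (x₀ : X) : Type _ :=
  closure (Set.range (subpowerEval x₀))

/-- The canonical map `X → h_P(X)`. -/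
def toSubpowerHigson {X : Type*} [MetricSpace X] (x₀ : X) (x : X) : SubpowerHigson x₀ :=
  ⟨subpowerEval x₀ x, subset_closure ⟨x, rfl⟩⟩

/-- The subpower Higson corona `ν_P(X) = h_P(X) \ X`. -/
def subpowerCorona {X : Type*} [MetricSpace X] (x₀ : X) : Set (SubpowerHigson x₀) :=
  (Set.range (toSubpowerHigson x₀))ᶜ

/-- The remainder `cl(S) \ S` of `S ⊆ X`, the closure being taken in `h_P(X)`. -/
def subpowerRemainder {X : Type*} [MetricSpace X] (x₀ : X) (S : Set X) :
    Set (SubpowerHigson x₀) :=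
  closure (toSubpowerHigson x₀ '' S) \ (toSubpowerHigson x₀ '' S)

/-- A continuum: a nonempty compact connected Hausdorff space (here a subspace `K` of `T`). -/
structure IsContinuum {T : Type*} [TopologicalSpace T] (K : Set T) : Prop where
  isConnected : IsConnected K
  isCompact : IsCompact K
  t2Space : T2Space K

/-- `L` is a proper subcontinuum of `K`. -/
def IsProperSubcontinuum {T : Type*} [TopologicalSpace T] (L K : Set T) : Prop :=
  IsContinuum L ∧ L ⊆ K ∧ L ≠ K

/-- A continuum is decomposable if it is the union of two of its proper subcontinua. -/
def IsDecomposableContinuum {T : Type*} [TopologicalSpace T] (K : Set T) : Prop :=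
  IsContinuum K ∧
    ∃ L M : Set T, IsProperSubcontinuum L K ∧ IsProperSubcontinuum M K ∧ K = L ∪ M

/-- The map `t ↦ (t, t sin t)` from `[0, ∞)` to the Euclidean plane. -/
def sineCurve (t : Set.Ici (0 : ℝ)) : EuclideanSpace ℝ (Fin 2) :=
  !₂[(t : ℝ), (t : ℝ) * Real.sin (t : ℝ)]

theorem sineCurve_injective : Function.Injective sineCurve := fun s t h => by
  have h0 := congrArg (fun v : EuclideanSpace ℝ (Fin 2) => v 0) h
  exact Subtype.ext (by simpa [sineCurve] using h0)

/-- The half-open interval `[0, ∞)`, to be equipped with the metric induced by `sineCurve`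
instead of the usual metric. -/
def SineRay : Type := Set.Ici (0 : ℝ)

namespace SineRay

/-- The identity map from `[0, ∞)` with the metric induced by `sineCurve` to `[0, ∞)` with its
usual metric. -/
def toIci (t : SineRay) : Set.Ici (0 : ℝ) := t

/-- The metric `ρ(s, t) = ‖sineCurve s - sineCurve t‖` on `[0, ∞)`. -/
instance instMetricSpace : MetricSpace SineRay :=
  MetricSpace.induced (fun t => sineCurve (toIci t)) sineCurve_injective inferInstance

/-- The base point `0`. -/
def base : SineRay := (⟨0, Set.self_mem_Ici⟩ : Set.Ici (0 : ℝ))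

/-- The part of the curve in the upper half plane. -/
def upper : Set SineRay := {t | 0 ≤ sineCurve (toIci t) 1}

/-- The part of the curve in the lower half plane. -/
def lower : Set SineRay := {t | sineCurve (toIci t) 1 ≤ 0}

end SineRay

end

/-!
The points of `h_P(X)` are limits of ultrafilters on `X`, tested coordinatewise on `C_P(X)`. Two
consequences carry the argument, for a proper metric space `X`.

* A function `g` with `|g x - g y| (1 + |x|) ≤ C ρ(x, y)` belongs to `C_P(X)`
  (`higsonSubpower_of_abs_sub_mul_le`). This applies to `1 / (1 + |x|)`, whose extension vanishes
  exactly on the corona, which is therefore compact and consists of the limits of nets tending to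
  infinity. On the sine ray it also applies to `sin t`, the slope of the curve seen from the origin.
* Nets that tend to infinity at bounded distance from each other have the same limits
  (`tendsto_toSubpowerHigson_of_dist_le`). Hence a set consisting of bounded connected pieces that
  escape to infinity, with bounded gaps between consecutive pieces, has a connected set of limits
  at infinity (`isConnected_closure_inter_subpowerCorona`): if two disjoint open sets separated
  these limits, all but finitely many pieces would each lie in one of them, and the endpoints of the
  infinitely many gaps at which the pieces switch sides would have a common limit on both sides.

The arcs of the curve above the axis have gaps of length `π` between them, and so have the arcs
below, so both remainders are connected. The extension of `sin` is nonnegative on the closure of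
`upper`, nonpositive on the closure of `lower`, and takes the values `1` and `-1` on the corona; so
neither remainder is the whole corona, and neither closure meets `X` in new points. The limits of
the points `n π` lie in both remainders, so their union, the corona, is connected.
-/

/-! ### Coordinates on the subpower Higson compactification -/

section General

variable {X : Type*} [MetricSpace X] {x₀ : X}

/-- The coordinate of a point of `h_P(X)` at `f ∈ C_P(X)`, that is, the continuous extension of
`f` to `h_P(X)`. -/
def subpowerExtend (f : subpowerFunctions x₀) (p : SubpowerHigson x₀) : ℝ := (p.1 f : ℝ)

theorem continuous_subpowerExtend (f : subpowerFunctions x₀) : Continuous (subpowerExtend f) :=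
  continuous_subtype_val.comp ((continuous_apply f).comp continuous_subtype_val)

theorem subpowerExtend_toSubpowerHigson (f : subpowerFunctions x₀) (x : X) :
    subpowerExtend f (toSubpowerHigson x₀ x) = (f : X →ᵇ ℝ) x := rfl

theorem tendsto_subpowerHigson_iff {ι : Type*} {F : Filter ι} {u : ι → SubpowerHigson x₀}
    {p : SubpowerHigson x₀} :
    Tendsto u F (𝓝 p) ↔
      ∀ f : subpowerFunctions x₀,
        Tendsto (fun i => subpowerExtend f (u i)) F (𝓝 (subpowerExtend f p)) := by
  rw [tendsto_subtype_rng, tendsto_pi_nhds]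
  exact forall_congr' fun f => tendsto_subtype_rng

theorem continuous_toSubpowerHigson : Continuous (toSubpowerHigson x₀) :=
  continuous_iff_continuousAt.2 fun _ => tendsto_subpowerHigson_iff.2 fun f =>
    (f : X →ᵇ ℝ).continuous.continuousAt

instance compactSpace_subpowerHigson : CompactSpace (SubpowerHigson x₀) :=
  isCompact_iff_compactSpace.1 isClosed_closure.isCompact

theorem denseRange_toSubpowerHigson : DenseRange (toSubpowerHigson x₀) := fun p => by
  rw [closure_subtype, ← Set.range_comp]
  exact p.2

theorem exists_ultrafilter_of_mem_closure {S : Set X} {p : SubpowerHigson x₀}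
    (hp : p ∈ closure (toSubpowerHigson x₀ '' S)) :
    ∃ F : Ultrafilter X, S ∈ F ∧ Tendsto (toSubpowerHigson x₀) F (𝓝 p) := by
  obtain ⟨G, hG, hGp⟩ := mem_closure_iff_ultrafilter.1 hp
  have := comap_inf_principal_neBot_of_image_mem G.neBot hG
  obtain ⟨F, hF⟩ := Ultrafilter.exists_le
    (comap (toSubpowerHigson x₀) (G : Filter (SubpowerHigson x₀)) ⊓ 𝓟 S)
  exact ⟨F, le_principal_iff.1 (hF.trans inf_le_right),
    (tendsto_iff_comap.2 (hF.trans inf_le_left)).mono_right hGp⟩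

theorem exists_tendsto_toSubpowerHigson {ι : Type*} (F : Ultrafilter ι) (u : ι → X) :
    ∃ p, Tendsto (fun i => toSubpowerHigson x₀ (u i)) F (𝓝 p) := by
  obtain ⟨p, -, hp⟩ := isCompact_univ.ultrafilter_le_nhds
    (F.map fun i => toSubpowerHigson x₀ (u i)) (by simp)
  exact ⟨p, hp⟩

/-- Two nets at bounded distance, one of which tends to infinity, have the same limits
in `h_P(X)`. -/
theorem tendsto_toSubpowerHigson_of_dist_le {ι : Type*} {F : Filter ι} {u v : ι → X} {r : ℝ}
    (hu : Tendsto (fun i => dist x₀ (u i)) F atTop) (huv : ∀ i, dist (u i) (v i) ≤ r)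
    {p : SubpowerHigson x₀} (hp : Tendsto (fun i => toSubpowerHigson x₀ (u i)) F (𝓝 p)) :
    Tendsto (fun i => toSubpowerHigson x₀ (v i)) F (𝓝 p) := by
  rw [tendsto_subpowerHigson_iff] at hp ⊢
  intro f
  have hs : AsymptoticallySubpower fun _ => |r| + 1 := by
    refine ⟨fun _ _ => by positivity, fun α hα => ?_⟩
    obtain ⟨t₀, ht₀⟩ := eventually_atTop.1 ((tendsto_rpow_atTop hα).eventually_gt_atTop (|r| + 1))
    exact ⟨max t₀ 1, by positivity, fun t ht => ht₀ t ((le_max_left _ _).trans ht.le)⟩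
  have hd := (f.2 _ hs).comp (tendsto_comap_iff.2 hu)
  have he : Tendsto (fun i => edist ((f : X →ᵇ ℝ) (v i)) ((f : X →ᵇ ℝ) (u i))) F (𝓝 0) := by
    refine tendsto_of_tendsto_of_tendsto_of_le_of_le tendsto_const_nhds hd
      (fun _ => zero_le) fun i => ?_
    have hr : 0 < |r| + 1 := by positivity
    refine Metric.edist_le_ediam_of_mem ⟨v i, ?_, rfl⟩ ⟨u i, Metric.mem_ball_self hr, rfl⟩
    rw [Metric.mem_ball, dist_comm]
    linarith [huv i, le_abs_self r]
  have hz : Tendsto (fun i => (f : X →ᵇ ℝ) (v i) - (f : X →ᵇ ℝ) (u i)) F (𝓝 0) := by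
    rw [tendsto_zero_iff_norm_tendsto_zero]
    simpa [edist_dist, Function.comp_def, Real.dist_eq] using
      (ENNReal.tendsto_toReal ENNReal.zero_ne_top).comp he
  simpa [subpowerExtend_toSubpowerHigson] using hz.add (hp f)

/-- A function whose oscillation decays like the reciprocal of the norm is Higson subpower, since
`t ^ (1 / 2) / (1 + t) → 0`. -/
theorem higsonSubpower_of_abs_sub_mul_le {g : X → ℝ} {C : ℝ}
    (hg : ∀ x y, |g x - g y| * (1 + dist x₀ x) ≤ C * dist x y) : HigsonSubpower x₀ g := by
  intro s hs
  obtain ⟨t₀, ht₀, hst⟩ := hs.2 (1 / 2) (by norm_num)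
  have hlim : Tendsto (fun t : ℝ => ENNReal.ofReal (2 * |C| * t ^ (-(1 / 2) : ℝ))) atTop (𝓝 0) := by
    simpa using ENNReal.tendsto_ofReal
      ((tendsto_rpow_neg_atTop (y := 1 / 2) (by norm_num)).const_mul (2 * |C|))
  refine tendsto_of_tendsto_of_tendsto_of_le_of_le' tendsto_const_nhds
    (hlim.comp tendsto_comap) (Eventually.of_forall fun _ => zero_le) ?_
  filter_upwards [tendsto_comap.eventually (eventually_gt_atTop t₀)] with x hx
  have hx0 : 0 < dist x₀ x := ht₀.trans hx
  have key : ∀ y ∈ Metric.ball x (s (dist x₀ x)),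
      |g x - g y| ≤ |C| * dist x₀ x ^ (-(1 / 2) : ℝ) := fun y hy => by
    have h1 : dist x y ≤ dist x₀ x ^ (1 / 2 : ℝ) := by
      rw [Metric.mem_ball, dist_comm] at hy
      exact (hy.trans (hst _ hx)).le
    have h2 : dist x₀ x ^ (1 / 2 : ℝ) = dist x₀ x ^ (-(1 / 2) : ℝ) * dist x₀ x := by
      rw [← Real.rpow_add_one hx0.ne']
      norm_num
    have h3 : |g x - g y| * dist x₀ x ≤ |C| * dist x₀ x ^ (-(1 / 2) : ℝ) * dist x₀ x :=
      calc |g x - g y| * dist x₀ x ≤ |g x - g y| * (1 + dist x₀ x) := by gcongr; linarith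
        _ ≤ C * dist x y := hg x y
        _ ≤ |C| * dist x y := by gcongr; exact le_abs_self C
        _ ≤ |C| * dist x₀ x ^ (1 / 2 : ℝ) := by gcongr
        _ = _ := by rw [h2, mul_assoc]
    exact le_of_mul_le_mul_right h3 hx0
  refine Metric.ediam_le ?_
  rintro _ ⟨y, hy, rfl⟩ _ ⟨z, hz, rfl⟩
  rw [edist_dist, Function.comp_apply]
  refine ENNReal.ofReal_le_ofReal ?_
  rw [Real.dist_eq]
  have := abs_sub_le (g y) (g x) (g z)
  rw [abs_sub_comm (g y) (g x)] at this
  linarith [key y hy, key z hz]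

/-! ### The corona as the set of points at infinity -/

/-- The function `x ↦ 1 / (1 + |x|)`. -/
noncomputable def decayFunction (x₀ : X) : X →ᵇ ℝ :=
  BoundedContinuousFunction.ofNormedAddCommGroup (fun x => (1 + dist x₀ x)⁻¹)
    ((continuous_const.add (continuous_const.dist continuous_id)).inv₀ fun x =>
      (add_pos_of_pos_of_nonneg one_pos dist_nonneg).ne') 1
    fun x => by
      have : 0 ≤ dist x₀ x := dist_nonneg
      rw [Real.norm_of_nonneg (by positivity)]
      exact inv_le_one_of_one_le₀ (by linarith)

theorem decayFunction_mem : decayFunction x₀ ∈ subpowerFunctions x₀ := by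
  refine higsonSubpower_of_abs_sub_mul_le (C := 1) fun x y => ?_
  have hx : 0 ≤ dist x₀ x := dist_nonneg
  have hy : 0 ≤ dist x₀ y := dist_nonneg
  change |(1 + dist x₀ x)⁻¹ - (1 + dist x₀ y)⁻¹| * (1 + dist x₀ x) ≤ _
  rw [inv_sub_inv (by positivity) (by positivity), abs_div, abs_of_pos (by positivity :
    0 < (1 + dist x₀ x) * (1 + dist x₀ y)), one_mul, div_mul_eq_mul_div,
    div_le_iff₀ (by positivity)]
  have h1 : |1 + dist x₀ y - (1 + dist x₀ x)| ≤ dist x y := by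
    rw [add_sub_add_left_eq_sub, abs_sub_comm, dist_comm x₀, dist_comm x₀]
    exact abs_dist_sub_le x y x₀
  have h2 : 0 ≤ dist x y * (1 + dist x₀ x) * dist x₀ y := by positivity
  nlinarith [mul_le_mul_of_nonneg_right h1 (by positivity : 0 ≤ 1 + dist x₀ x)]

/-- The limit in `h_P(X)` of a net that tends to infinity in `X` lies in the corona. -/
theorem mem_subpowerCorona_of_tendsto {ι : Type*} {F : Filter ι} [F.NeBot] {u : ι → X}
    (hu : Tendsto (fun i => dist x₀ (u i)) F atTop) {p : SubpowerHigson x₀}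
    (hp : Tendsto (fun i => toSubpowerHigson x₀ (u i)) F (𝓝 p)) : p ∈ subpowerCorona x₀ := by
  rintro ⟨x, rfl⟩
  have h1 := tendsto_subpowerHigson_iff.1 hp ⟨decayFunction x₀, decayFunction_mem⟩
  have h2 : Tendsto (fun i => (1 + dist x₀ (u i))⁻¹) F (𝓝 0) :=
    (tendsto_atTop_add_const_left _ 1 hu).inv_tendsto_atTop
  have h3 : (1 + dist x₀ x)⁻¹ = 0 := tendsto_nhds_unique h1 h2
  have : 0 < 1 + dist x₀ x := by positivity
  exact (inv_pos.2 this).ne' h3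

theorem tendsto_dist_of_mem_subpowerCorona [ProperSpace X] {p : SubpowerHigson x₀}
    (hp : p ∈ subpowerCorona x₀) {F : Filter X}
    (hF : Tendsto (toSubpowerHigson x₀) F (𝓝 p)) :
    Tendsto (fun x => dist x₀ x) F atTop := by
  refine tendsto_atTop.2 fun R => ?_
  have hc : IsClosed (toSubpowerHigson x₀ '' Metric.closedBall x₀ R) :=
    ((isCompact_closedBall x₀ R).image continuous_toSubpowerHigson).isClosed
  have hm : p ∈ (toSubpowerHigson x₀ '' Metric.closedBall x₀ R)ᶜ := by
    rintro ⟨x, -, hx⟩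
    exact hp ⟨x, hx⟩
  filter_upwards [hF.eventually (hc.isOpen_compl.mem_nhds hm)] with x hx
  by_contra! h
  exact hx ⟨x, by rw [Metric.mem_closedBall, dist_comm]; exact h.le, rfl⟩

/-- The corona is the zero set of the extension of `1 / (1 + |x|)`. -/
theorem isClosed_subpowerCorona [ProperSpace X] : IsClosed (subpowerCorona x₀) := by
  let f : subpowerFunctions x₀ := ⟨decayFunction x₀, decayFunction_mem⟩
  suffices h : subpowerCorona x₀ = subpowerExtend f ⁻¹' {0} by
    rw [h]
    exact isClosed_singleton.preimage (continuous_subpowerExtend f)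
  ext p
  refine ⟨fun hp => ?_, ?_⟩
  · obtain ⟨F, -, hF⟩ := exists_ultrafilter_of_mem_closure (S := Set.univ) (p := p)
      (by rw [Set.image_univ]; exact denseRange_toSubpowerHigson p)
    exact tendsto_nhds_unique (tendsto_subpowerHigson_iff.1 hF f)
      (tendsto_atTop_add_const_left _ 1
        (tendsto_dist_of_mem_subpowerCorona hp hF)).inv_tendsto_atTop
  · rintro hp ⟨x, rfl⟩
    have hx : 0 < 1 + dist x₀ x := by positivity
    exact (inv_pos.2 hx).ne' hp

/-! ### Connectedness of remainders -/

/-- If `S` is a sequence of bounded connected pieces that escape to infinity, consecutive pieces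
being at bounded distance, then the set of limits at infinity of `S` is connected. -/
theorem isConnected_closure_inter_subpowerCorona [ProperSpace X] {S : Set X} {C : ℕ → Set X}
    (hS : S = ⋃ k, C k) (hC : ∀ k, IsPreconnected (C k)) (hb : ∀ k, Bornology.IsBounded (C k))
    (hesc : ∀ R : ℝ, ∀ᶠ k in atTop, ∀ x ∈ C k, R ≤ dist x₀ x) {u v : ℕ → X} {r : ℝ}
    (hu : ∀ k, u k ∈ C k) (hv : ∀ k, v k ∈ C (k + 1)) (huv : ∀ k, dist (u k) (v k) ≤ r) :
    IsConnected (closure (toSubpowerHigson x₀ '' S) ∩ subpowerCorona x₀) := by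
  have hCS : ∀ k, C k ⊆ S := fun k => hS ▸ Set.subset_iUnion C k
  have hlim : ∀ w : ℕ → X, (∀ k, w k ∈ C k) → ∀ F : Ultrafilter ℕ, (F : Filter ℕ) ≤ atTop →
      ∃ p ∈ closure (toSubpowerHigson x₀ '' S) ∩ subpowerCorona x₀,
        Tendsto (fun k => dist x₀ (w k)) F atTop ∧
        Tendsto (fun k => toSubpowerHigson x₀ (w k)) F (𝓝 p) := fun w hw F hF => by
    obtain ⟨p, hp⟩ := exists_tendsto_toSubpowerHigson (x₀ := x₀) F w
    have hd : Tendsto (fun k => dist x₀ (w k)) F atTop :=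
      tendsto_atTop.2 fun R => hF ((hesc R).mono fun k hk => hk _ (hw k))
    exact ⟨p, ⟨mem_closure_of_tendsto hp (Eventually.of_forall fun k => ⟨_, hCS k (hw k), rfl⟩),
      mem_subpowerCorona_of_tendsto hd hp⟩, hd, hp⟩
  refine ⟨?_, isPreconnected_closed_iff.2 fun A B hA hB hAB hneA hneB => ?_⟩
  · obtain ⟨p, hp, -⟩ := hlim u hu (hyperfilter ℕ) (Nat.hyperfilter_le_atTop)
    exact ⟨p, hp⟩
  set T := closure (toSubpowerHigson x₀ '' S) ∩ subpowerCorona x₀ with hT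
  have hTc : IsClosed T := isClosed_closure.inter isClosed_subpowerCorona
  by_contra hne
  have hdisj : Disjoint (T ∩ A) (T ∩ B) := Set.disjoint_left.2 fun p hpA hpB =>
    hne ⟨p, hpA.1, hpA.2, hpB.2⟩
  obtain ⟨U, V, hU, hV, hAU, hBV, hUV⟩ := normal_separation (hTc.inter hA) (hTc.inter hB) hdisj
  have hTUV : T ⊆ U ∪ V := fun p hp =>
    (hAB hp).imp (fun h => hAU ⟨hp, h⟩) fun h => hBV ⟨hp, h⟩
  -- Otherwise points of infinitely many pieces outside `U ∪ V` would have a limit in `T`.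
  have hcover : ∀ᶠ k in atTop, toSubpowerHigson x₀ '' C k ⊆ U ∪ V := by
    by_contra hcon
    rw [not_eventually] at hcon
    have hw : ∀ k, ∃ x ∈ C k, ¬ toSubpowerHigson x₀ '' C k ⊆ U ∪ V →
        toSubpowerHigson x₀ x ∉ U ∪ V := fun k => by
      by_cases h : toSubpowerHigson x₀ '' C k ⊆ U ∪ V
      · exact ⟨u k, hu k, fun h' => absurd h h'⟩
      · obtain ⟨_, ⟨x, hx, rfl⟩, hxn⟩ := Set.not_subset.1 h
        exact ⟨x, hx, fun _ => hxn⟩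
    choose w hwC hwn using hw
    have := frequently_iff_neBot.1 hcon
    obtain ⟨F, hF⟩ :=
      Ultrafilter.exists_le (atTop ⊓ 𝓟 {k | ¬ toSubpowerHigson x₀ '' C k ⊆ U ∪ V})
    obtain ⟨p, hp, -, hpt⟩ := hlim w hwC F (hF.trans inf_le_left)
    have h1 : ∀ᶠ k in (F : Filter ℕ), toSubpowerHigson x₀ (w k) ∈ U ∪ V :=
      hpt.eventually ((hU.union hV).mem_nhds (hTUV hp))
    have h2 : ∀ᶠ k in (F : Filter ℕ), ¬ toSubpowerHigson x₀ '' C k ⊆ U ∪ V :=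
      le_principal_iff.1 (hF.trans inf_le_right)
    obtain ⟨k, hk1, hk2⟩ := (h1.and h2).exists
    exact hwn k hk2 hk1
  have hor : ∀ᶠ k in atTop, toSubpowerHigson x₀ '' C k ⊆ U ∨ toSubpowerHigson x₀ '' C k ⊆ V :=
    hcover.mono fun k hk =>
      ((hC k).image _ continuous_toSubpowerHigson.continuousOn).subset_or_subset hU hV hUV hk
  -- Finitely many pieces are bounded, hence have no limit in the corona.
  have hfreq : ∀ W W' : Set (SubpowerHigson x₀), IsOpen W → Disjoint W W' → (T ∩ W).Nonempty →
      ∃ᶠ k in atTop, ¬ toSubpowerHigson x₀ '' C k ⊆ W' := by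
    rintro W W' hW hWW' ⟨p, ⟨hpS, hpc⟩, hpW⟩ hcon
    obtain ⟨N, hN⟩ := eventually_atTop.1 hcon
    obtain ⟨F, hSF, hF⟩ := exists_ultrafilter_of_mem_closure hpS
    have hbd : Bornology.IsBounded (⋃ k ∈ Set.Iio N, C k) :=
      (Bornology.isBounded_biUnion (Set.finite_Iio N)).2 fun k _ => hb k
    obtain ⟨R, hR⟩ := hbd.subset_closedBall x₀
    obtain ⟨x, hxS, hxW, hxR⟩ := ((show ∀ᶠ x in (F : Filter X), x ∈ S from hSF).and
      ((hF.eventually (hW.mem_nhds hpW)).and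
        ((tendsto_dist_of_mem_subpowerCorona hpc hF).eventually_gt_atTop R))).exists
    rw [hS] at hxS
    obtain ⟨k, hk⟩ := Set.mem_iUnion.1 hxS
    rcases lt_or_ge k N with hkN | hkN
    · have := hR (Set.mem_biUnion (show k ∈ Set.Iio N from hkN) hk)
      rw [Metric.mem_closedBall, dist_comm] at this
      exact absurd hxR this.not_gt
    · exact Set.disjoint_left.1 hWW' hxW (not_not.1 (hN k hkN) ⟨x, hk, rfl⟩)
  have hfU := hfreq U V hU hUV (hneA.mono fun p hp => ⟨hp.1, hAU hp⟩)
  have hfV := hfreq V U hV hUV.symm (hneB.mono fun p hp => ⟨hp.1, hBV hp⟩)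
  have htrans : ∃ᶠ k in atTop,
      toSubpowerHigson x₀ '' C k ⊆ U ∧ toSubpowerHigson x₀ '' C (k + 1) ⊆ V := by
    intro hcon
    obtain ⟨N, hN⟩ := eventually_atTop.1 (hor.and hcon)
    obtain ⟨k, hkN, hk⟩ := frequently_atTop.1 hfU N
    obtain ⟨m, hmk, hm⟩ := frequently_atTop.1 hfV k
    refine hm (Nat.le_induction ((hN k hkN).1.resolve_right hk) (fun n hn ih => ?_) m hmk)
    exact (hN (n + 1) (by omega)).1.resolve_right fun h => (hN n (by omega)).2 ⟨ih, h⟩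
  -- At a limit of transitions, `u k` and `v k` have the same limit but lie in disjoint sets.
  have := frequently_iff_neBot.1 htrans
  obtain ⟨F, hF⟩ := Ultrafilter.exists_le (atTop ⊓ 𝓟 {k | toSubpowerHigson x₀ '' C k ⊆ U ∧
    toSubpowerHigson x₀ '' C (k + 1) ⊆ V})
  obtain ⟨p, hp, hd, hpu⟩ := hlim u hu F (hF.trans inf_le_left)
  have hpv := tendsto_toSubpowerHigson_of_dist_le hd huv hpu
  have hev : ∀ᶠ k in (F : Filter ℕ), toSubpowerHigson x₀ '' C k ⊆ U ∧
    toSubpowerHigson x₀ '' C (k + 1) ⊆ V := le_principal_iff.1 (hF.trans inf_le_right)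
  rcases hTUV hp with h | h
  · obtain ⟨k, hk, hkU⟩ := (hev.and (hpv.eventually (hU.mem_nhds h))).exists
    exact Set.disjoint_left.1 hUV hkU (hk.2 ⟨_, hv k, rfl⟩)
  · obtain ⟨k, hk, hkV⟩ := (hev.and (hpu.eventually (hV.mem_nhds h))).exists
    exact Set.disjoint_left.1 hUV (hk.1 ⟨_, hu k, rfl⟩) hkV

end General

/-! ### The sine ray -/

theorem continuous_sineCurve : Continuous sineCurve := by
  refine (PiLp.continuous_toLp 2 _).comp (continuous_pi fun i => ?_)
  fin_cases i
  · exact continuous_subtype_val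
  · exact continuous_subtype_val.mul (Real.continuous_sin.comp continuous_subtype_val)

theorem isEmbedding_sineCurve : IsEmbedding sineCurve :=
  .of_comp continuous_sineCurve (EuclideanSpace.proj (𝕜 := ℝ) (0 : Fin 2)).continuous
    IsEmbedding.subtypeVal

namespace SineRay

/-- The parameter of a point of the ray, as a real number. -/
def param (t : SineRay) : ℝ := (toIci t : ℝ)

/-- The point of the ray with parameter `max t 0`. -/
noncomputable def ofReal (t : ℝ) : SineRay :=
  (⟨max t 0, Set.mem_Ici.2 (le_max_right t 0)⟩ : Set.Ici (0 : ℝ))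

theorem param_nonneg (t : SineRay) : 0 ≤ t.param := (toIci t).2

theorem param_ofReal {t : ℝ} (ht : 0 ≤ t) : (ofReal t).param = t := max_eq_left ht

theorem dist_eq_sqrt (s t : SineRay) :
    dist s t = √((s.param - t.param) ^ 2 +
      (s.param * Real.sin s.param - t.param * Real.sin t.param) ^ 2) := by
  change dist (sineCurve (toIci s)) (sineCurve (toIci t)) = _
  rw [EuclideanSpace.dist_eq]
  simp [Fin.sum_univ_two, sineCurve, Real.dist_eq, sq_abs, param]

theorem abs_param_sub_le_dist (s t : SineRay) : |s.param - t.param| ≤ dist s t := by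
  rw [dist_eq_sqrt]
  exact Real.abs_le_sqrt (le_add_of_nonneg_right (sq_nonneg _))

theorem abs_height_sub_le_dist (s t : SineRay) :
    |s.param * Real.sin s.param - t.param * Real.sin t.param| ≤ dist s t := by
  rw [dist_eq_sqrt]
  exact Real.abs_le_sqrt (le_add_of_nonneg_left (sq_nonneg _))

theorem param_base : base.param = 0 := rfl

theorem param_le_dist_base (t : SineRay) : t.param ≤ dist base t := by
  have := abs_param_sub_le_dist base t
  rwa [param_base, zero_sub, abs_neg, abs_of_nonneg t.param_nonneg] at this

theorem dist_base_le (t : SineRay) : dist base t ≤ 2 * t.param := by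
  rw [dist_eq_sqrt, param_base]
  refine Real.sqrt_le_iff.2 ⟨by linarith [t.param_nonneg], ?_⟩
  nlinarith [Real.sin_sq_le_one t.param, sq_nonneg t.param]

theorem isHomeomorph_toIci : IsHomeomorph toIci := by
  refine (Homeomorph.mk (Equiv.refl (Set.Ici (0 : ℝ))) ?_ ?_ :
    SineRay ≃ₜ Set.Ici (0 : ℝ)).isHomeomorph
  · refine (LipschitzWith.of_dist_le_mul (K := 1) fun s t => ?_ :
      LipschitzWith 1 (toIci)).continuous
    rw [NNReal.coe_one, one_mul]
    exact abs_param_sub_le_dist s t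
  · exact continuous_induced_rng.2 continuous_sineCurve

theorem continuous_param : Continuous param :=
  continuous_subtype_val.comp isHomeomorph_toIci.continuous

theorem continuous_ofReal : Continuous ofReal :=
  continuous_induced_rng.2 (continuous_sineCurve.comp
    ((continuous_id.max continuous_const).subtype_mk _))

theorem ofReal_param (t : SineRay) : ofReal t.param = t :=
  Subtype.ext (max_eq_left t.param_nonneg : max t.param 0 = t.param)

theorem isCompact_param_preimage_Icc (a b : ℝ) : IsCompact (param ⁻¹' Set.Icc a b) := by
  refine (isCompact_Icc.image continuous_ofReal).of_isClosed_subset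
    (isClosed_Icc.preimage continuous_param) fun t ht => ⟨t.param, ht, ofReal_param t⟩

theorem isPreconnected_param_preimage_Icc (a b : ℝ) : IsPreconnected (param ⁻¹' Set.Icc a b) := by
  have h : param ⁻¹' Set.Icc a b = ofReal '' (Set.Icc a b ∩ Set.Ici 0) := by
    ext t
    refine ⟨fun ht => ⟨t.param, ⟨ht, t.param_nonneg⟩, ofReal_param t⟩, ?_⟩
    rintro ⟨x, ⟨hx, hx0⟩, rfl⟩
    rwa [Set.mem_preimage, param_ofReal hx0]
  rw [h]
  exact (Set.ordConnected_Icc.inter Set.ordConnected_Ici).isPreconnected.image _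
    continuous_ofReal.continuousOn

instance properSpace : ProperSpace SineRay := by
  refine ⟨fun x r => (isCompact_param_preimage_Icc (x.param - r) (x.param + r)).of_isClosed_subset
    Metric.isClosed_closedBall fun t ht => ?_⟩
  have := abs_le.1 ((abs_param_sub_le_dist t x).trans (Metric.mem_closedBall.1 ht))
  exact ⟨by linarith, by linarith⟩

/-- The function `t ↦ sin t` on the ray. -/
noncomputable def sine : SineRay →ᵇ ℝ :=
  BoundedContinuousFunction.ofNormedAddCommGroup (fun t => Real.sin t.param)
    (Real.continuous_sin.comp continuous_param) 1 fun _ => Real.abs_sin_le_one _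

/-- The slope `sin t = (t sin t) / t` varies by at most `O(ρ(s, t) / t)`, because both
coordinates of the curve are `1`-Lipschitz for `ρ`. -/
theorem sine_mem : sine ∈ subpowerFunctions base := by
  refine higsonSubpower_of_abs_sub_mul_le (C := 5) fun s t => ?_
  change |Real.sin s.param - Real.sin t.param| * (1 + dist base s) ≤ 5 * dist s t
  have h1 := abs_param_sub_le_dist s t
  have h2 := abs_height_sub_le_dist s t
  have h3 : |Real.sin s.param - Real.sin t.param| ≤ |s.param - t.param| := by
    simpa [Real.dist_eq] using Real.lipschitzWith_sin.dist_le_mul s.param t.param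
  have h4 : |Real.sin s.param - Real.sin t.param| * s.param ≤ 2 * dist s t := by
    calc |Real.sin s.param - Real.sin t.param| * s.param
        = |(Real.sin s.param - Real.sin t.param) * s.param| := by
          rw [abs_mul, abs_of_nonneg s.param_nonneg]
      _ = |(s.param * Real.sin s.param - t.param * Real.sin t.param) -
            (s.param - t.param) * Real.sin t.param| := by ring_nf
      _ ≤ |s.param * Real.sin s.param - t.param * Real.sin t.param| +
            |(s.param - t.param) * Real.sin t.param| := abs_sub _ _
      _ ≤ dist s t + dist s t * 1 := by
          rw [abs_mul]
          gcongr
          exact Real.abs_sin_le_one _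
      _ = 2 * dist s t := by ring
  have h5 := mul_le_mul_of_nonneg_left (dist_base_le s)
    (abs_nonneg (Real.sin s.param - Real.sin t.param))
  linarith

theorem mem_upper_iff {t : SineRay} : t ∈ upper ↔ 0 ≤ Real.sin t.param := by
  change 0 ≤ t.param * Real.sin t.param ↔ _
  rcases t.param_nonneg.eq_or_lt with h | h
  · simp [← h]
  · exact mul_nonneg_iff_of_pos_left h

theorem mem_lower_iff {t : SineRay} : t ∈ lower ↔ Real.sin t.param ≤ 0 := by
  change t.param * Real.sin t.param ≤ 0 ↔ _
  rcases t.param_nonneg.eq_or_lt with h | h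
  · simp [← h]
  · exact ⟨fun h' => nonpos_of_mul_nonpos_right h' h, mul_nonpos_of_nonneg_of_nonpos h.le⟩

/-- For `c = 0` and `c = 1`: the set where `sin t` is nonpositive, respectively nonnegative. -/
def half (c : ℕ) : Set SineRay := {t | 0 ≤ (-1) ^ (c + 1) * Real.sin t.param}

theorem upper_eq_half : upper = half 1 := by
  ext t
  rw [mem_upper_iff]
  simp [half]

theorem lower_eq_half : lower = half 0 := by
  ext t
  rw [mem_lower_iff]
  simp [half]

/-- The points with parameter between `(m - 1) π` and `m π`; for `m = 0` only the base point. -/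
def arc (m : ℕ) : Set SineRay := param ⁻¹' Set.Icc ((m - 1) * Real.pi) (m * Real.pi)

theorem half_eq_iUnion_arc {c : ℕ} (hc : c ≤ 1) : half c = ⋃ k : ℕ, arc (2 * k + c) := by
  have hpi := Real.pi_pos
  ext t
  rw [Set.mem_iUnion]
  have hsin : ∀ m : ℕ, Real.sin t.param = -((-1) ^ m * Real.sin (m * Real.pi - t.param)) :=
    fun m => by rw [← Real.sin_nat_mul_pi_sub, sub_sub_cancel]
  constructor
  · intro ht
    obtain ⟨m, hm1, hm2⟩ : ∃ m : ℕ, (m - 1) * Real.pi < t.param ∧ t.param ≤ m * Real.pi := by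
      refine ⟨⌈t.param / Real.pi⌉₊, ?_, ?_⟩
      · rw [← lt_div_iff₀ hpi, sub_lt_iff_lt_add]
        exact Nat.ceil_lt_add_one (div_nonneg t.param_nonneg hpi.le)
      · rw [← div_le_iff₀ hpi]
        exact Nat.le_ceil _
    rcases Nat.even_or_odd (m + c) with hmc | hmc
    · refine ⟨(m - c) / 2, ?_⟩
      rw [show 2 * ((m - c) / 2) + c = m by obtain ⟨n, hn⟩ := hmc; omega]
      exact ⟨hm1.le, hm2⟩
    -- On a piece of the wrong sign, `(m - 1) π < t ≤ m π` and `sin t = 0` force `t = m π`.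
    · have hm : t.param = m * Real.pi := by
        by_contra hne
        have hpos : 0 < Real.sin (m * Real.pi - t.param) :=
          Real.sin_pos_of_pos_of_lt_pi (sub_pos.2 (lt_of_le_of_ne hm2 hne)) (by linarith)
        have h : 0 ≤ (-1) ^ (c + 1) * Real.sin t.param := ht
        rw [hsin m, show (-1 : ℝ) ^ (c + 1) * -((-1) ^ m * Real.sin (m * Real.pi - t.param)) =
          (-1) ^ (m + c) * Real.sin (m * Real.pi - t.param) by ring, hmc.neg_one_pow] at h
        linarith
      refine ⟨(m + 1 - c) / 2, ?_⟩
      rw [show 2 * ((m + 1 - c) / 2) + c = m + 1 by obtain ⟨n, hn⟩ := hmc; omega]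
      change _ ∧ _
      push_cast
      constructor <;> linarith
  · rintro ⟨k, hk1, hk2⟩
    change 0 ≤ (-1) ^ (c + 1) * Real.sin t.param
    rw [hsin (2 * k + c), show (-1 : ℝ) ^ (c + 1) *
      -((-1) ^ (2 * k + c) * Real.sin ((2 * k + c : ℕ) * Real.pi - t.param)) =
        ((-1) ^ (k + c)) ^ 2 * Real.sin ((2 * k + c : ℕ) * Real.pi - t.param) by ring]
    exact mul_nonneg (sq_nonneg _)
      (Real.sin_nonneg_of_nonneg_of_le_pi (by linarith) (by linarith))

/-- The point with parameter `n π`. -/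
noncomputable def node (n : ℕ) : SineRay := ofReal (n * Real.pi)

theorem param_node (n : ℕ) : (node n).param = n * Real.pi := param_ofReal (by positivity)

theorem node_mem_half (n c : ℕ) : node n ∈ half c := by
  simp [half, param_node, Real.sin_nat_mul_pi]

theorem dist_node_succ (n : ℕ) : dist (node n) (node (n + 1)) = Real.pi := by
  rw [dist_eq_sqrt, param_node, param_node, Real.sin_nat_mul_pi, Real.sin_nat_mul_pi, mul_zero,
    mul_zero, sub_zero, zero_pow two_ne_zero, add_zero, Real.sqrt_sq_eq_abs, abs_sub_comm,
    ← sub_mul, Nat.cast_succ, add_sub_cancel_left, one_mul, abs_of_pos Real.pi_pos]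

theorem le_dist_base_of_le_param {t : SineRay} {n : ℕ} (h : n * Real.pi ≤ t.param) :
    (n : ℝ) ≤ dist base t := by
  have h1 : (n : ℝ) * 1 ≤ n * Real.pi := by
    gcongr
    linarith [Real.pi_gt_three]
  linarith [t.param_le_dist_base]

theorem tendsto_dist_base_of_le_param {u : ℕ → SineRay} (h : ∀ n : ℕ, n * Real.pi ≤ (u n).param) :
    Tendsto (fun n => dist base (u n)) atTop atTop :=
  tendsto_atTop_mono (fun n => le_dist_base_of_le_param (h n)) tendsto_natCast_atTop_atTop

theorem isConnected_closure_half_inter_corona {c : ℕ} (hc : c ≤ 1) :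
    IsConnected (closure (toSubpowerHigson base '' half c) ∩ subpowerCorona base) := by
  have hpi := Real.pi_pos
  refine isConnected_closure_inter_subpowerCorona (half_eq_iUnion_arc hc)
    (fun k => isPreconnected_param_preimage_Icc _ _)
    (fun k => (isCompact_param_preimage_Icc _ _).isBounded) (fun R => ?_)
    (u := fun k => node (2 * k + c)) (v := fun k => node (2 * k + c + 1)) (r := Real.pi)
    (fun k => ?_) (fun k => ?_) fun k => (dist_node_succ _).le
  · filter_upwards [eventually_ge_atTop 1,
      tendsto_natCast_atTop_atTop.eventually_ge_atTop R] with k hk hkR t ht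
    refine hkR.trans (le_dist_base_of_le_param (le_trans ?_ ht.1))
    have : (1 : ℝ) ≤ k := by exact_mod_cast hk
    gcongr
    push_cast
    linarith [(Nat.cast_nonneg c : (0 : ℝ) ≤ c)]
  · refine ⟨?_, ?_⟩ <;> rw [param_node] <;> linarith
  · constructor <;> (rw [param_node]; push_cast; nlinarith)

/-- The extension of `sin` to `h_P(X)` keeps its sign on the closure of each half. -/
theorem nonneg_of_mem_closure_half {c : ℕ} {p : SubpowerHigson base}
    (hp : p ∈ closure (toSubpowerHigson base '' half c)) :
    0 ≤ (-1) ^ (c + 1) * subpowerExtend ⟨sine, sine_mem⟩ p := by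
  have hcl : IsClosed {q : SubpowerHigson base |
      0 ≤ (-1) ^ (c + 1) * subpowerExtend ⟨sine, sine_mem⟩ q} :=
    isClosed_le continuous_const (continuous_const.mul (continuous_subpowerExtend _))
  refine closure_minimal ?_ hcl hp
  rintro _ ⟨t, ht, rfl⟩
  exact ht

theorem subpowerRemainder_half (c : ℕ) :
    subpowerRemainder base (half c) =
      closure (toSubpowerHigson base '' half c) ∩ subpowerCorona base := by
  ext p
  refine and_congr_right fun hp => not_congr ⟨fun ⟨t, _, h⟩ => ⟨t, h⟩, ?_⟩
  rintro ⟨t, rfl⟩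
  exact ⟨t, nonneg_of_mem_closure_half hp, rfl⟩

/-- The extrema of the other half, where `sin` is `± 1`, accumulate at a point of the corona
outside the closure of the given half. -/
theorem exists_mem_corona_notMem_closure_half (c : ℕ) :
    ∃ p ∈ subpowerCorona base, p ∉ closure (toSubpowerHigson base '' half c) := by
  let u : ℕ → SineRay := fun k => ofReal (Real.pi / 2 + (2 * k + c : ℕ) * Real.pi)
  have hu : ∀ k, (u k).param = Real.pi / 2 + (2 * k + c : ℕ) * Real.pi := fun k =>
    param_ofReal (by positivity)
  have hpi := Real.pi_pos
  have hd : Tendsto (fun k => dist base (u k)) atTop atTop :=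
    tendsto_dist_base_of_le_param fun k => by
      rw [hu]
      push_cast
      have h1 : 0 ≤ (k : ℝ) * Real.pi := by positivity
      have h2 : 0 ≤ (c : ℝ) * Real.pi := by positivity
      linarith
  obtain ⟨p, hp⟩ := exists_tendsto_toSubpowerHigson (x₀ := base) (hyperfilter ℕ) u
  refine ⟨p, mem_subpowerCorona_of_tendsto (hd.mono_left Nat.hyperfilter_le_atTop) hp,
    fun hmem => ?_⟩
  have h1 := nonneg_of_mem_closure_half hmem
  have h2 := tendsto_subpowerHigson_iff.1 hp ⟨sine, sine_mem⟩
  have h3 : ∀ k, subpowerExtend ⟨sine, sine_mem⟩ (toSubpowerHigson base (u k)) = (-1) ^ c :=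
    fun k => by
      change Real.sin (u k).param = _
      rw [hu, Real.sin_add_nat_mul_pi, Real.sin_pi_div_two, pow_add, pow_mul]
      simp
  simp_rw [h3] at h2
  rw [tendsto_nhds_unique h2 tendsto_const_nhds] at h1
  rw [← pow_add, show c + 1 + c = 2 * c + 1 by ring, pow_succ, pow_mul, neg_one_sq] at h1
  norm_num at h1

theorem isProperSubcontinuum_remainder_half {c : ℕ} (hc : c ≤ 1) :
    IsProperSubcontinuum (subpowerRemainder base (half c)) (subpowerCorona base) := by
  rw [subpowerRemainder_half]
  refine ⟨⟨isConnected_closure_half_inter_corona hc,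
    (isClosed_closure.inter isClosed_subpowerCorona).isCompact, inferInstance⟩,
    Set.inter_subset_right, fun h => ?_⟩
  obtain ⟨p, hp, hpn⟩ := exists_mem_corona_notMem_closure_half c
  exact hpn (h.ge hp).1

theorem subpowerCorona_eq_union :
    subpowerCorona base = subpowerRemainder base (half 1) ∪ subpowerRemainder base (half 0) := by
  rw [subpowerRemainder_half, subpowerRemainder_half, ← Set.union_inter_distrib_right,
    ← closure_union, ← Set.image_union, eq_comm, Set.inter_eq_right]
  have h : half 1 ∪ half 0 = Set.univ := by
    rw [← upper_eq_half, ← lower_eq_half, Set.eq_univ_iff_forall]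
    exact fun t => le_total 0 (sineCurve (toIci t) 1)
  rw [h, Set.image_univ, denseRange_toSubpowerHigson.closure_range]
  exact Set.subset_univ _

/-- Both halves contain the nodes, hence their remainders share the limits of the nodes. -/
theorem nonempty_remainder_half_inter :
    (subpowerRemainder base (half 1) ∩ subpowerRemainder base (half 0)).Nonempty := by
  rw [subpowerRemainder_half, subpowerRemainder_half]
  obtain ⟨p, hp⟩ := exists_tendsto_toSubpowerHigson (x₀ := base) (hyperfilter ℕ) node
  have hd : Tendsto (fun n => dist base (node n)) atTop atTop :=
    tendsto_dist_base_of_le_param fun n => (param_node n).ge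
  have hc := mem_subpowerCorona_of_tendsto (hd.mono_left Nat.hyperfilter_le_atTop) hp
  have hcl : ∀ c, p ∈ closure (toSubpowerHigson base '' half c) := fun c =>
    mem_closure_of_tendsto hp (Eventually.of_forall fun n => ⟨_, node_mem_half n c, rfl⟩)
  exact ⟨p, ⟨hcl 1, hc⟩, hcl 0, hc⟩

theorem isContinuum_subpowerCorona : IsContinuum (subpowerCorona base) := by
  refine ⟨?_, isClosed_subpowerCorona.isCompact, inferInstance⟩
  rw [subpowerCorona_eq_union]
  exact (isProperSubcontinuum_remainder_half le_rfl).1.isConnected.union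
    nonempty_remainder_half_inter (isProperSubcontinuum_remainder_half zero_le_one).1.isConnected

end SineRay

theorem mainTheorem6 :
    -- `t ↦ (t, t sin t)` is an embedding, and the metric that it induces on `[0, ∞)` is proper
    -- and compatible with the usual topology
    IsEmbedding sineCurve ∧ IsHomeomorph SineRay.toIci ∧ ProperSpace SineRay ∧
    -- the corona is the union of the two parts, which are proper subcontinua of it
    IsContinuum (subpowerCorona SineRay.base) ∧
    subpowerCorona SineRay.base =
      subpowerRemainder SineRay.base SineRay.upper ∪
        subpowerRemainder SineRay.base SineRay.lower ∧
    IsProperSubcontinuum (subpowerRemainder SineRay.base SineRay.upper)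
      (subpowerCorona SineRay.base) ∧
    IsProperSubcontinuum (subpowerRemainder SineRay.base SineRay.lower)
      (subpowerCorona SineRay.base) ∧
    IsDecomposableContinuum (subpowerCorona SineRay.base) := by
  rw [SineRay.upper_eq_half, SineRay.lower_eq_half]
  have hY := SineRay.isProperSubcontinuum_remainder_half le_rfl
  have hZ := SineRay.isProperSubcontinuum_remainder_half zero_le_one
  exact ⟨isEmbedding_sineCurve, SineRay.isHomeomorph_toIci, SineRay.properSpace,
    SineRay.isContinuum_subpowerCorona, SineRay.subpowerCorona_eq_union, hY, hZ,
    SineRay.isContinuum_subpowerCorona, _, _, hY, hZ, SineRay.subpowerCorona_eq_union⟩
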